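/- Let $E$ be a convenient vector space, i.e. a Hausdorff locally convex real topological vector space in which every continuous curve $c:\mathbb R\to E$ such that $\ell\circ c$ is smooth for all continuous linear functionals $\ell$ on $E$ is smooth. Let $E'$ be the space of continuous linear functionals on $E$ with the strong topology. A map is called smooth if it maps smooth curves to smooth curves. Let $M$ be a smooth manifold modelled on $E$ (for instance a Banach or Fréchet manifold), with tangent bundle $TM$ (fibres modelled on $E$) and cotangent bundle $T'M$ (fibres modelled on $E'$). Let $\eta\in\Omega^1(M)$ be a contact form: at every point $d\eta$ is degenerate (has non-zero kernel), and $TM=\mathrm{Hor}\oplus\mathrm{Ver}$, where $\mathrm{Hor}=\ker\eta$ and $\mathrm{Ver}=\ker(v\mapsto d\eta(v,\cdot))$. Define $$\flat: TM\to T'M,\qquad \flat(v)=\iota_v d\eta+\eta(v)\,\eta .$$ Then $(\mathrm{Hor},d\eta|_{\mathrm{Hor}})$ is a strongly symplectic distribution, i.e. $z\mapsto d\eta(z,\cdot)|_{\mathrm{Hor}}$ is an isomorphism of vector bundles $\mathrm{Hor}\to\mathrm{Hor}'$, if and only if $\flat: TM\to T'M$ is an isomorphism of vector bundles. Here an isomorphism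 of vector bundles is a fibre-preserving bijection which, together with its inverse, is smooth, and which is a linear homeomorphism on each fibre. -/

import Mathlib

open scoped Topology Manifold ContDiff

namespace ConvenientContact

section Calculus

variable {E F : Type*} [AddCommGroup E] [Module ℝ E] [TopologicalSpace E]
  [AddCommGroup F] [Module ℝ F] [TopologicalSpace F]

/-- The curve `c` in a topological vector space has derivative `c'` at time `t`:
the difference quotients `(c (t + h) - c t) / h` converge to `c'` as `h → 0`, `h ≠ 0`. -/
def HasCurveDerivAt (c : ℝ → F) (c' : F) (t : ℝ) : Prop :=
  Filter.Tendsto (fun h : ℝ => h⁻¹ • (c (t + h) - c t)) (𝓝[≠] 0) (𝓝 c')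

/-- Smooth curves `ℝ → F`: all iterated derivatives `d 0 = c, d 1 = c', d 2 = c'', …` exist
(each `d n` is then continuous, being differentiable). -/
def SmoothCurve (c : ℝ → F) : Prop :=
  ∃ d : ℕ → ℝ → F, d 0 = c ∧ ∀ n t, HasCurveDerivAt (d n) (d (n + 1) t) t

/-- Smoothness in the sense of convenient calculus: `f` is smooth on `U` if it maps smooth curves
in `U` to smooth curves. -/
def ConvSmoothOn (f : E → F) (U : Set E) : Prop :=
  ∀ c : ℝ → E, SmoothCurve c → (∀ t, c t ∈ U) → SmoothCurve (fun t => f (c t))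

end Calculus

/-- Convenient vector spaces (the ambient assumptions "topological vector space", "Hausdorff" and
"locally convex" are separate type classes): a continuous curve which is smooth when composed with
every continuous linear functional is smooth. -/
class ConvenientSpace (E : Type*) [AddCommGroup E] [Module ℝ E] [TopologicalSpace E] : Prop where
  smooth_of_scalarwise : ∀ c : ℝ → E, Continuous c →
    (∀ l : E →L[ℝ] ℝ, ContDiff ℝ ∞ (fun t => l (c t))) → SmoothCurve c

section Manifold

variable (E : Type*) [AddCommGroup E] [Module ℝ E] [TopologicalSpace E]
  [IsTopologicalAddGroup E] [ContinuousSMul ℝ E]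
  (M : Type*) [TopologicalSpace M] [ChartedSpace E M]

/-- `M` is a smooth manifold modelled on `E`: its charts are homeomorphisms from open subsets of `M`
onto open subsets of `E`, and all transition maps are smooth. -/
class ConvenientManifold : Prop where
  smooth_transition : ∀ e ∈ atlas E M, ∀ e' ∈ atlas E M,
    ConvSmoothOn (fun u => e' (e.symm u)) (e.symm ≫ₕ e').source

/-- A (kinematic, smooth) 1-form on `M`, that is, a smooth section of the cotangent bundle `T'M`,
given by its local representatives `η_e : e.target → E'`, where `e` runs through the atlas
and `E'`, the continuous dual of `E`, carries the strong topology (uniform convergence on bounded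
sets). `compat` says that the representatives agree under the transition maps of the tangent
bundle: if `w` is the derivative of the transition map `τ = e' ∘ e⁻¹` at `u` in direction `v`, then
`η_e(u)(v) = η_{e'}(τ u)(w)`. The values of `rep e` for `e` not in the atlas, or outside `e.target`,
play no role. -/
structure OneForm where
  rep : OpenPartialHomeomorph M E → E → (E →L[ℝ] ℝ)
  smooth : ∀ e ∈ atlas E M, ConvSmoothOn (rep e) e.target
  compat : ∀ e ∈ atlas E M, ∀ e' ∈ atlas E M, ∀ u ∈ (e.symm ≫ₕ e').source, ∀ v w : E,
    HasCurveDerivAt (fun t : ℝ => e' (e.symm (u + t • v))) w 0 →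
      rep e u v = rep e' (e' (e.symm u)) w

end Manifold

section Contact

variable {E : Type*} [AddCommGroup E] [Module ℝ E] [TopologicalSpace E]
  [IsTopologicalAddGroup E] [ContinuousSMul ℝ E]
  {M : Type*} [TopologicalSpace M] [ChartedSpace E M]

namespace OneForm

variable (η : OneForm E M)

/-- The exterior derivative `dη`, in the chart `e`, at the point with coordinate `u`, evaluated on
the tangent vectors with coordinates `v` and `w`:
`dη(v, w) = D_v (η(w)) - D_w (η(v))` for constant `v`, `w`. -/
noncomputable def d (e : OpenPartialHomeomorph M E) (u v w : E) : ℝ :=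
  deriv (fun t : ℝ => η.rep e (u + t • v) w) 0 - deriv (fun t : ℝ => η.rep e (u + t • w) v) 0

/-- The horizontal distribution `Hor = ker η` at `u`, in the chart `e`. -/
def hor (e : OpenPartialHomeomorph M E) (u : E) : Submodule ℝ E :=
  LinearMap.ker (η.rep e u : E →ₗ[ℝ] ℝ)

/-- The vertical distribution `Ver = ker dη` at `u`, in the chart `e`. -/
def ver (e : OpenPartialHomeomorph M E) (u : E) : Set E :=
  {v | ∀ w, η.d e u v w = 0}

/-- `η` is a contact form: at every point `dη` is degenerate, and `TM = Hor ⊕ Ver`. -/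
structure IsContactForm : Prop where
  degenerate : ∀ e ∈ atlas E M, ∀ u ∈ e.target, ∃ v ∈ η.ver e u, v ≠ 0
  disjoint : ∀ e ∈ atlas E M, ∀ u ∈ e.target, ∀ v ∈ η.hor e u, v ∈ η.ver e u → v = 0
  span : ∀ e ∈ atlas E M, ∀ u ∈ e.target, ∀ v, ∃ h ∈ η.hor e u, ∃ r ∈ η.ver e u, v = h + r

/-- `(Hor, dη|_Hor)` is a strongly symplectic distribution: `z ↦ dη(z, ·)|_Hor` is an isomorphism
from the bundle `Hor` onto its dual bundle `Hor'`. In each chart there are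
toplinear isomorphisms `Ψ u : Hor_u ≃ Hor_u'`, given by `dη`, depending smoothly on `u` together
with their inverses, that is, `Ψ` maps smooth curves in the total space of `Hor` to smooth curves in
the total space of `Hor'`, and so does its inverse in the other direction. Here `Hor` has the smooth
structure of a subbundle of `TM` (with charts `e.target × E`) and `Hor'` that of a quotient bundle
of `T'M` (with charts `e.target × E'`): a curve in `Hor'` is smooth when it is the restriction to
`Hor` of a smooth curve in `T'M` over the same base curve. -/
def IsStronglySymplecticHor : Prop :=
  ∀ e ∈ atlas E M, ∃ Ψ : ∀ u : e.target, η.hor e u ≃L[ℝ] (η.hor e u →L[ℝ] ℝ),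
    (∀ (u : e.target) (z y : η.hor e u), Ψ u z y = η.d e u z y) ∧
    (∀ γ : ℝ → e.target, SmoothCurve (fun t => (γ t : E)) →
      ∀ z : (∀ t, η.hor e (γ t)), SmoothCurve (fun t => (z t : E)) →
        ∃ L : ℝ → (E →L[ℝ] ℝ), SmoothCurve L ∧ ∀ t (y : η.hor e (γ t)), Ψ (γ t) (z t) y = L t y) ∧
    (∀ γ : ℝ → e.target, SmoothCurve (fun t => (γ t : E)) →
      ∀ L : ℝ → (E →L[ℝ] ℝ), SmoothCurve L →
        SmoothCurve (fun t =>
          ((Ψ (γ t)).symm ((L t).comp (η.hor e (γ t)).subtypeL) : E)))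

/-- The map `♭ : TM → T'M`, `♭(v) = ι_v dη + η(v) η`, in the chart `e`, at the point with
coordinate `u`: the value of `♭(v)` at `w`. -/
noncomputable def flat (e : OpenPartialHomeomorph M E) (u v w : E) : ℝ :=
  η.d e u v w + η.rep e u v * η.rep e u w

/-- `♭ : TM → T'M` is an isomorphism of vector bundles: in each chart there are toplinear
isomorphisms `Φ u : E ≃ E'`, given by `♭`, such that `(u, v) ↦ (u, Φ u v)` and its inverse
`(u, l) ↦ (u, (Φ u)⁻¹ l)` are smooth maps between `e.target × E` and `e.target × E'`. -/
def FlatIsIso : Prop :=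
  ∀ e ∈ atlas E M, ∃ Φ : e.target → (E ≃L[ℝ] (E →L[ℝ] ℝ)),
    (∀ (u : e.target) (v w : E), Φ u v w = η.flat e u v w) ∧
    (∀ γ : ℝ → e.target, SmoothCurve (fun t => (γ t : E)) →
      ∀ v : ℝ → E, SmoothCurve v → SmoothCurve (fun t => Φ (γ t) (v t))) ∧
    (∀ γ : ℝ → e.target, SmoothCurve (fun t => (γ t : E)) →
      ∀ L : ℝ → (E →L[ℝ] ℝ), SmoothCurve L → SmoothCurve (fun t => (Φ (γ t)).symm (L t)))

end OneForm

end Contact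

end ConvenientContact

open ConvenientContact

/-! A contact form has at each point a Reeb vector `ξ` with `η(ξ) = 1` and `dη(ξ, ·) = 0`. Along `E
= Hor ⊕ ℝξ` the map `♭` is block diagonal: it is `dη` on `Hor` and sends `ξ` to `η`. Pointwise, the
equivalence is therefore linear algebra with the projection onto `Hor` along `ξ`. The substance is
smoothness.

If `♭` is an isomorphism, then `ξ = ♭⁻¹(η)` is smooth along curves, and the inverse on `Hor'` is
`♭⁻¹` followed by the projection.

Conversely, it must be shown that `♭` itself maps smooth curves to smooth curves of the strong dual
`E'`, which is not assumed convenient. Two facts serve here. First, `dη(v, w)` is a smooth scalar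
function along smooth curves for constant `v`, `w`, and it is bilinear; since smoothness is only
tested on curves, this needs a Boman type argument (`contDiff_deriv_of_bounded`,
`ArcSmooth.deriv_diag`). Second, the isomorphism `♭ : E ≃ E'` at a single point, with the skew
symmetry of `dη`, forces every functional on `E'` to be an evaluation (`exists_eq_eval`), so
pointwise smooth curves in `E'` are smooth (`smoothCurve_dual_of_pointwise`). Near a given time, `ξ`
is then recovered by solving for it in the horizontal part of a constant vector. -/

namespace ConvenientContact

open Filter Set Bornology

/-! ### Smooth curves and the pairing of `E'` with `E` -/

section Calculus

theorem hasCurveDerivAt_real_iff {c : ℝ → ℝ} {c' t : ℝ} :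
    HasCurveDerivAt c c' t ↔ HasDerivAt c c' t :=
  hasDerivAt_iff_tendsto_slope_zero.symm

theorem contDiff_of_hasDerivAt_seq {d : ℕ → ℝ → ℝ}
    (h : ∀ n t, HasDerivAt (d n) (d (n + 1) t) t) (m n : ℕ) : ContDiff ℝ m (d n) := by
  induction m generalizing n with
  | zero =>
    simpa using (continuous_iff_continuousAt.2 fun t => (h n t).continuousAt : Continuous (d n))
  | succ m ih =>
    have hd : deriv (d n) = d (n + 1) := funext fun t => (h n t).deriv
    rw [Nat.cast_succ, contDiff_succ_iff_deriv]
    exact ⟨fun t => (h n t).differentiableAt, by simp, hd ▸ ih (n + 1)⟩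

theorem smoothCurve_real_iff {c : ℝ → ℝ} : SmoothCurve c ↔ ContDiff ℝ ∞ c := by
  constructor
  · rintro ⟨d, rfl, hd⟩
    exact contDiff_infty.2 fun n =>
      contDiff_of_hasDerivAt_seq (fun n t => hasCurveDerivAt_real_iff.1 (hd n t)) n 0
  · intro hc
    refine ⟨fun n => iteratedDeriv n c, iteratedDeriv_zero, fun n t => ?_⟩
    rw [hasCurveDerivAt_real_iff]
    simp only [iteratedDeriv_succ]
    exact ((hc.differentiable_iteratedDeriv n
      (by exact_mod_cast WithTop.coe_lt_top n)) t).hasDerivAt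

variable {E F : Type*} [AddCommGroup E] [Module ℝ E] [TopologicalSpace E]
  [AddCommGroup F] [Module ℝ F] [TopologicalSpace F]

theorem HasCurveDerivAt.clm (T : E →L[ℝ] F) {c : ℝ → E} {c' : E} {t : ℝ}
    (h : HasCurveDerivAt c c' t) : HasCurveDerivAt (fun s => T (c s)) (T c') t := by
  have := (T.continuous.tendsto c').comp h
  refine this.congr fun s => ?_
  simp

theorem SmoothCurve.clm (T : E →L[ℝ] F) {c : ℝ → E} (h : SmoothCurve c) :
    SmoothCurve (fun t => T (c t)) := by
  obtain ⟨d, rfl, hd⟩ := h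
  exact ⟨fun n t => T (d n t), rfl, fun n t => (hd n t).clm T⟩

theorem SmoothCurve.contDiff_clm {c : ℝ → E} (h : SmoothCurve c) (l : E →L[ℝ] ℝ) :
    ContDiff ℝ ∞ (fun t => l (c t)) :=
  smoothCurve_real_iff.1 (h.clm l)

theorem HasCurveDerivAt.continuousAt [IsTopologicalAddGroup E] [ContinuousSMul ℝ E]
    {c : ℝ → E} {c' : E} {t : ℝ} (h : HasCurveDerivAt c c' t) : ContinuousAt c t := by
  have h1 : Tendsto (fun s : ℝ => s) (𝓝[≠] 0) (𝓝 0) := tendsto_nhdsWithin_of_tendsto_nhds tendsto_id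
  have h2 := (h1.smul h).add_const (c t)
  rw [zero_smul, zero_add] at h2
  have h3 : Tendsto (fun s : ℝ => c (t + s)) (𝓝[≠] 0) (𝓝 (c t)) := by
    refine h2.congr' ?_
    filter_upwards [self_mem_nhdsWithin] with s hs
    rw [smul_inv_smul₀ hs, sub_add_cancel]
  have h4 : ContinuousAt (fun s : ℝ => c (t + s)) 0 := by
    rw [continuousAt_iff_punctured_nhds]
    simpa using h3
  have h5 : ContinuousAt (fun s : ℝ => s - t) t := by fun_prop
  have := ContinuousAt.comp (g := fun s : ℝ => c (t + s)) (f := fun s : ℝ => s - t) (x := t)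
    (by simpa using h4) h5
  simpa [Function.comp_def] using this

theorem SmoothCurve.continuous [IsTopologicalAddGroup E] [ContinuousSMul ℝ E]
    {c : ℝ → E} (h : SmoothCurve c) : Continuous c := by
  obtain ⟨d, rfl, hd⟩ := h
  exact continuous_iff_continuousAt.2 fun t => (hd 0 t).continuousAt

/-- Evaluation at a point, as a continuous functional on the strong dual. -/
def evalAt [IsTopologicalAddGroup E] [ContinuousSMul ℝ E] (w : E) : (E →L[ℝ] ℝ) →L[ℝ] ℝ where
  toFun l := l w
  map_add' _ _ := rfl
  map_smul' _ _ := rfl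
  cont := continuous_eval_const w

@[simp]
theorem evalAt_apply [IsTopologicalAddGroup E] [ContinuousSMul ℝ E] (w : E) (l : E →L[ℝ] ℝ) :
    evalAt w l = l w := rfl

/-- Evaluation `E' × E → ℝ` need not be jointly continuous. The product rule survives because `x`
maps a compact time interval to a bounded set, on which the difference quotients of `L` converge
uniformly in the strong topology. -/
theorem HasCurveDerivAt.pairing [IsTopologicalAddGroup E] [ContinuousSMul ℝ E]
    {L : ℝ → (E →L[ℝ] ℝ)} {L' : E →L[ℝ] ℝ} {x : ℝ → E} {x' : E} {t : ℝ}
    (hL : HasCurveDerivAt L L' t) (hx : HasCurveDerivAt x x' t) (hc : Continuous x) :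
    HasDerivAt (fun s => L s (x s)) (L' (x t) + L t x') t := by
  rw [← hasCurveDerivAt_real_iff]
  have hxt : Tendsto (fun h : ℝ => x (t + h)) (𝓝[≠] 0) (𝓝 (x t)) := by
    have : Tendsto (fun h : ℝ => x (t + h)) (𝓝 0) (𝓝 (x (t + 0))) :=
      (by fun_prop : Continuous fun h : ℝ => x (t + h)).tendsto 0
    rw [add_zero] at this
    exact tendsto_nhdsWithin_of_tendsto_nhds this
  have h1 : Tendsto (fun h : ℝ => (h⁻¹ • (L (t + h) - L t) - L') (x (t + h))) (𝓝[≠] 0) (𝓝 0) := by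
    have hL0 := hL.sub_const L'
    rw [sub_self] at hL0
    have hB : IsVonNBounded ℝ (x '' Icc (t - 1) (t + 1)) :=
      (isCompact_Icc.image hc).isVonNBounded ℝ
    intro V hV
    rw [mem_map]
    have := hL0 (ContinuousLinearMap.hasBasis_nhds_zero.mem_of_mem
      (i := (x '' Icc (t - 1) (t + 1), V)) ⟨hB, hV⟩)
    have hI : ∀ᶠ h : ℝ in 𝓝[≠] 0, h ∈ Icc (-1 : ℝ) 1 :=
      mem_nhdsWithin_of_mem_nhds (Icc_mem_nhds (by norm_num) (by norm_num))
    filter_upwards [this, hI] with h hh hi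
    exact hh _ ⟨t + h, ⟨by linarith [hi.1], by linarith [hi.2]⟩, rfl⟩
  have h2 := (L'.continuous.tendsto _).comp hxt
  have h3 := hx.clm (L t)
  have := (h1.add h2).add h3
  rw [zero_add] at this
  refine this.congr fun h => ?_
  simp only [Function.comp_apply, sub_apply, smul_apply,
    smul_eq_mul]
  ring

theorem SmoothCurve.pairing [IsTopologicalAddGroup E] [ContinuousSMul ℝ E]
    {L : ℝ → (E →L[ℝ] ℝ)} {x : ℝ → E} (hL : SmoothCurve L) (hx : SmoothCurve x) :
    ContDiff ℝ ∞ (fun t => L t (x t)) := by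
  obtain ⟨d, rfl, hd⟩ := hL
  obtain ⟨y, rfl, hy⟩ := hx
  -- The pairings of all derivatives of `L` and `x` are treated together, since this family is
  -- closed under differentiation up to sums.
  have key : ∀ m i j : ℕ, ContDiff ℝ m (fun t => d i t (y j t)) := by
    intro m
    have hder : ∀ i j t, HasDerivAt (fun t => d i t (y j t))
        (d (i + 1) t (y j t) + d i t (y (j + 1) t)) t := fun i j t =>
      (hd i t).pairing (hy j t) (continuous_iff_continuousAt.2 fun t => (hy j t).continuousAt)
    induction m with
    | zero =>
      intro i j
      simpa using (continuous_iff_continuousAt.2 fun t => (hder i j t).continuousAt)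
    | succ m ih =>
      intro i j
      rw [Nat.cast_succ, contDiff_succ_iff_deriv]
      refine ⟨fun t => (hder i j t).differentiableAt, by simp, ?_⟩
      rw [funext fun t => (hder i j t).deriv]
      exact (ih (i + 1) j).add (ih i (j + 1))
  exact contDiff_infty.2 fun m => key m 0 0

end Calculus

/-! ### Mackey's theorem and scalarwise tests of smoothness -/

section Mackey

/-- Regard `S` inside the bidual of the seminormed space `(E, p)`. The dual is complete, so the
uniform boundedness principle applies, and Hahn-Banach recovers `p x` from the bidual norm. -/
theorem exists_seminorm_bound_of_weakly_bounded {E : Type*} [AddCommGroup E] [Module ℝ E]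
    (p : Seminorm ℝ E) (S : Set E)
    (h : ∀ l : E →ₗ[ℝ] ℝ, (∃ C, ∀ x, |l x| ≤ C * p x) → ∃ C, ∀ x ∈ S, |l x| ≤ C) :
    ∃ C, ∀ x ∈ S, p x ≤ C := by
  let _ : SeminormedAddCommGroup E := p.toAddGroupSeminorm.toSeminormedAddCommGroup
  have hn : ∀ x : E, ‖x‖ = p x := fun _ => rfl
  let _ : NormedSpace ℝ E := ⟨fun a x => by simp [hn, map_smul_eq_mul]⟩
  obtain ⟨C, hC⟩ := banach_steinhaus (𝕜 := ℝ) (𝕜₂ := ℝ) (σ₁₂ := RingHom.id ℝ)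
    (g := fun x : S => NormedSpace.inclusionInDoubleDual ℝ E x) (by
      intro l
      obtain ⟨C, hC⟩ := h l ⟨‖l‖, fun x => l.le_opNorm x⟩
      exact ⟨C, fun x => hC x x.2⟩)
  refine ⟨C, fun x hx => ?_⟩
  obtain ⟨g, hg, hgx⟩ := exists_dual_vector'' ℝ x
  have h1 := (NormedSpace.inclusionInDoubleDual ℝ E x).le_opNorm g
  rw [NormedSpace.dual_def, hgx] at h1
  have h2 := hC ⟨x, hx⟩
  have h3 : ‖x‖ ≤ ‖NormedSpace.inclusionInDoubleDual ℝ E x‖ := by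
    calc ‖x‖ ≤ ‖((‖x‖ : ℝ))‖ := le_abs_self _
      _ ≤ _ := h1
      _ ≤ _ := mul_le_of_le_one_right (norm_nonneg _) hg
  exact h3.trans h2

variable {E : Type*} [AddCommGroup E] [Module ℝ E] [TopologicalSpace E]
  [IsTopologicalAddGroup E] [ContinuousSMul ℝ E] [LocallyConvexSpace ℝ E]

/-- **Mackey's theorem**: weakly bounded subsets of a locally convex space are bounded. -/
theorem isVonNBounded_of_weakly_bounded {S : Set E}
    (h : ∀ l : E →L[ℝ] ℝ, ∃ C, ∀ x ∈ S, |l x| ≤ C) : IsVonNBounded ℝ S := by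
  have hw := with_gaugeSeminormFamily (𝕜 := ℝ) (E := E)
  rw [hw.isVonNBounded_iff_seminorm_bounded]
  intro i
  obtain ⟨C, hC⟩ := exists_seminorm_bound_of_weakly_bounded (gaugeSeminormFamily ℝ E i) S (by
    rintro l ⟨C, hl⟩
    have hcont : Continuous l := by
      refine WithSeminorms.continuous_of_isBounded (p := gaugeSeminormFamily ℝ E)
        (q := fun _ : Fin 1 => normSeminorm ℝ ℝ) hw (norm_withSeminorms ℝ ℝ) l ?_
      intro _
      refine ⟨{i}, C.toNNReal, fun x => ?_⟩
      simp only [Seminorm.comp_apply, coe_normSeminorm, Finset.sup_singleton, smul_apply]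
      refine (hl x).trans ?_
      exact mul_le_mul_of_nonneg_right (Real.le_coe_toNNReal C) (apply_nonneg _ _)
    exact h ⟨l, hcont⟩)
  exact ⟨max C 0 + 1, by positivity, fun x hx => by
    linarith [hC x hx, le_max_left C 0]⟩

/-- A curve in a locally convex space is continuous if it is scalarwise continuously
differentiable. -/
theorem continuous_of_scalarwise_contDiff {c : ℝ → E}
    (h : ∀ l : E →L[ℝ] ℝ, ContDiff ℝ 1 (fun t => l (c t))) : Continuous c := by
  refine continuous_iff_continuousAt.2 fun t => ?_
  -- Scalarwise Lipschitz bounds make the difference quotients weakly bounded, hence bounded;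
  -- multiplied by `s - t → 0` they tend to zero.
  have hb : IsVonNBounded ℝ ((fun s => (s - t)⁻¹ • (c s - c t)) '' Icc (t - 1) (t + 1)) := by
    refine isVonNBounded_of_weakly_bounded fun l => ?_
    obtain ⟨K, hK⟩ := ((h l).contDiffOn (s := Icc (t - 1) (t + 1))).exists_lipschitzOnWith
      (by norm_num) (convex_Icc _ _) isCompact_Icc
    refine ⟨K, ?_⟩
    rintro _ ⟨s, hs, rfl⟩
    have h1 := hK.dist_le_mul s hs t ⟨by linarith, by linarith⟩
    simp only [map_smul, map_sub, smul_eq_mul, abs_mul, abs_inv]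
    rw [Real.dist_eq, Real.dist_eq] at h1
    rcases eq_or_ne s t with rfl | hst
    · simp
    · rw [inv_mul_le_iff₀ (abs_pos.2 (sub_ne_zero.2 hst))]
      linarith
  have h0 : Tendsto (fun s : ℝ => s - t) (𝓝 t) (𝓝 0) := by
    simpa using (by fun_prop : Continuous fun s : ℝ => s - t).tendsto t
  have h1 := hb.smul_tendsto_zero (x := fun s => (s - t)⁻¹ • (c s - c t)) (l := 𝓝 t) (by
    filter_upwards [Icc_mem_nhds (show t - 1 < t by linarith) (show t < t + 1 by linarith)]
      with s hs using ⟨s, hs, rfl⟩) h0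
  have h2 := h1.add_const (c t)
  rw [zero_add] at h2
  refine h2.congr fun s => ?_
  rcases eq_or_ne s t with rfl | hst
  · simp
  · simp [smul_inv_smul₀ (sub_ne_zero.2 hst)]

theorem smoothCurve_iff_scalarwise [ConvenientSpace E] {c : ℝ → E} :
    SmoothCurve c ↔ ∀ l : E →L[ℝ] ℝ, ContDiff ℝ ∞ (fun t => l (c t)) :=
  ⟨fun h l => h.contDiff_clm l, fun h => ConvenientSpace.smooth_of_scalarwise c
    (continuous_of_scalarwise_contDiff fun l => (h l).of_le (by simp)) h⟩

variable [ConvenientSpace E]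

theorem SmoothCurve.add {c d : ℝ → E} (hc : SmoothCurve c) (hd : SmoothCurve d) :
    SmoothCurve (fun t => c t + d t) :=
  smoothCurve_iff_scalarwise.2 fun l => by
    simpa using (hc.contDiff_clm l).add (hd.contDiff_clm l)

theorem SmoothCurve.sub {c d : ℝ → E} (hc : SmoothCurve c) (hd : SmoothCurve d) :
    SmoothCurve (fun t => c t - d t) :=
  smoothCurve_iff_scalarwise.2 fun l => by
    simpa using (hc.contDiff_clm l).sub (hd.contDiff_clm l)

theorem SmoothCurve.smul {a : ℝ → ℝ} {c : ℝ → E} (ha : ContDiff ℝ ∞ a) (hc : SmoothCurve c) :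
    SmoothCurve (fun t => a t • c t) :=
  smoothCurve_iff_scalarwise.2 fun l => by
    simpa using ha.mul (hc.contDiff_clm l)

theorem SmoothCurve.comp {a : ℝ → ℝ} {c : ℝ → E} (hc : SmoothCurve c) (ha : ContDiff ℝ ∞ a) :
    SmoothCurve (fun t => c (a t)) :=
  smoothCurve_iff_scalarwise.2 fun l => (hc.contDiff_clm l).comp ha

theorem smoothCurve_const (v : E) : SmoothCurve (fun _ => v) :=
  smoothCurve_iff_scalarwise.2 fun _ => contDiff_const

/-- If `E` is isomorphic to its strong dual and every functional on the strong dual is an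
evaluation, then pointwise smooth curves in the strong dual are smooth. -/
theorem smoothCurve_dual_of_pointwise (T : E ≃L[ℝ] (E →L[ℝ] ℝ))
    (hT : ∀ ℓ : (E →L[ℝ] ℝ) →L[ℝ] ℝ, ∃ w, ∀ l, ℓ l = l w) {L : ℝ → (E →L[ℝ] ℝ)}
    (hL : ∀ w, ContDiff ℝ ∞ (fun t => L t w)) : SmoothCurve L := by
  have h : SmoothCurve (fun t => T.symm (L t)) := smoothCurve_iff_scalarwise.2 fun l => by
    obtain ⟨w, hw⟩ := hT (l.comp (T.symm : (E →L[ℝ] ℝ) →L[ℝ] E))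
    have : (fun t => l (T.symm (L t))) = fun t => L t w := funext fun t => hw (L t)
    rw [this]
    exact hL w
  simpa using h.clm (T : E →L[ℝ] (E →L[ℝ] ℝ))

end Mackey

/-! ### Taylor estimates and interpolation of derivatives -/

section Landau

theorem abs_sub_taylor_le {f : ℝ → ℝ} (hf : ContDiff ℝ ∞ f) {n : ℕ} {B : ℝ}
    (hB : ∀ x, |iteratedDeriv (n + 1) f x| ≤ B) (x : ℝ) {h : ℝ} (hh : 0 ≤ h) :
    |f (x + h) - ∑ k ∈ Finset.range (n + 1), iteratedDeriv k f x * h ^ k / k.factorial| ≤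
      B * h ^ (n + 1) := by
  -- The extra `1` keeps the interval nondegenerate when `h = 0`.
  have hlt : x < x + h + 1 := by linarith
  have hu : UniqueDiffOn ℝ (Icc x (x + h + 1)) := uniqueDiffOn_Icc hlt
  have hf' : ∀ m : ℕ, ContDiff ℝ m f := fun m => hf.of_le (by exact_mod_cast le_top)
  have hw : ∀ (m : ℕ), ∀ y ∈ Icc x (x + h + 1),
      iteratedDerivWithin m f (Icc x (x + h + 1)) y = iteratedDeriv m f y := fun m y hy =>
    iteratedDerivWithin_eq_iteratedDeriv hu (hf' m).contDiffAt hy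
  have := taylor_mean_remainder_bound (f := f) (a := x) (b := x + h + 1) (C := B) (x := x + h)
    (n := n) hlt.le (by exact_mod_cast (hf' (n + 1)).contDiffOn) ⟨by linarith, by linarith⟩
    (fun y hy => by rw [hw _ y hy]; exact hB y)
  rw [taylor_within_apply] at this
  simp only [add_sub_cancel_left, smul_eq_mul, Real.norm_eq_abs] at this
  have hB0 : 0 ≤ B := (abs_nonneg _).trans (hB x)
  calc _ = _ := by
        congr 2
        refine Finset.sum_congr rfl fun k _ => ?_
        rw [hw k x ⟨le_rfl, hlt.le⟩]
        ring
    _ ≤ _ := this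
    _ ≤ _ := div_le_self (by positivity) (by exact_mod_cast Nat.one_le_iff_ne_zero.2 n.factorial_ne_zero)

/-- A Landau-Kolmogorov type inequality: the intermediate derivatives of a function are controlled
by the function and its derivative of order `n + 1`. -/
theorem exists_abs_iteratedDeriv_le (n : ℕ) : ∃ C : ℝ, 0 ≤ C ∧ ∀ (f : ℝ → ℝ) (A B δ : ℝ),
    ContDiff ℝ ∞ f → (∀ x, |f x| ≤ A) → (∀ x, |iteratedDeriv (n + 1) f x| ≤ B) → 0 ≤ δ →
    ∀ k ≤ n, ∀ x, |iteratedDeriv k f x| * δ ^ k ≤ C * (A + B * δ ^ (n + 1)) := by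
  -- Taylor expansion at the nodes `x + mδ`, `m = 0, …, n`, gives a Vandermonde system for the
  -- scaled derivatives at `x`; inverting it bounds each of them.
  set V : Matrix (Fin (n + 1)) (Fin (n + 1)) ℝ := Matrix.vandermonde fun i => (i : ℝ) with hV
  have hdet : IsUnit V.det := isUnit_iff_ne_zero.2
    (Matrix.det_vandermonde_ne_zero_iff.2 fun i j hij => Fin.ext (by exact_mod_cast hij))
  set S : ℝ := ∑ k, ∑ m, |V⁻¹ k m| with hS
  refine ⟨n.factorial * (S * (n + 1) ^ (n + 1)), by positivity, ?_⟩
  intro f A B δ hf hA hB hδ k hk x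
  have hA0 : 0 ≤ A := (abs_nonneg _).trans (hA x)
  have hB0 : 0 ≤ B := (abs_nonneg _).trans (hB x)
  set c : Fin (n + 1) → ℝ := fun j => iteratedDeriv j f x * δ ^ (j : ℕ) / (j : ℕ).factorial with hc
  set R : ℝ := (n + 1) ^ (n + 1) * (A + B * δ ^ (n + 1)) with hR
  have hVc : ∀ m, |(V.mulVec c) m| ≤ R := by
    intro m
    have h1 := abs_sub_taylor_le hf hB x (h := m * δ) (by positivity)
    have h2 : (V.mulVec c) m = ∑ k ∈ Finset.range (n + 1),
        iteratedDeriv k f x * (m * δ) ^ k / k.factorial := by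
      rw [Finset.sum_range]
      simp only [Matrix.mulVec, dotProduct, hV, Matrix.vandermonde_apply, hc]
      exact Finset.sum_congr rfl fun j _ => by rw [mul_pow]; ring
    rw [← h2] at h1
    have h3 : |(V.mulVec c) m| ≤ A + B * (m * δ) ^ (n + 1) := by
      have := abs_sub_abs_le_abs_sub ((V.mulVec c) m) (f (x + m * δ))
      rw [abs_sub_comm] at this
      linarith [hA (x + m * δ)]
    have hm : (m : ℝ) ≤ n + 1 := by exact_mod_cast m.2.le
    have h4 : (1 : ℝ) ≤ (n + 1) ^ (n + 1) := one_le_pow₀ (by linarith [Nat.cast_nonneg (α := ℝ) n])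
    have h5 : (m * δ) ^ (n + 1) ≤ ((n : ℝ) + 1) ^ (n + 1) * δ ^ (n + 1) := by
      rw [mul_pow]; gcongr
    calc _ ≤ _ := h3
      _ ≤ ((n : ℝ) + 1) ^ (n + 1) * A + B * (((n : ℝ) + 1) ^ (n + 1) * δ ^ (n + 1)) := by
        gcongr
        exact le_mul_of_one_le_left hA0 h4
      _ = R := by rw [hR]; ring
  set j : Fin (n + 1) := ⟨k, Nat.lt_succ_of_le hk⟩ with hj
  have hcj : c j = ∑ m, V⁻¹ j m * (V.mulVec c) m := by
    have : (V⁻¹).mulVec (V.mulVec c) = c := by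
      rw [Matrix.mulVec_mulVec, Matrix.nonsing_inv_mul _ hdet, Matrix.one_mulVec]
    conv_lhs => rw [← this]
    rfl
  have hcj' : |c j| ≤ S * R := by
    rw [hcj]
    calc _ ≤ ∑ m, |V⁻¹ j m * (V.mulVec c) m| := Finset.abs_sum_le_sum_abs _ _
      _ ≤ ∑ m, |V⁻¹ j m| * R := by
        refine Finset.sum_le_sum fun m _ => ?_
        rw [abs_mul]
        exact mul_le_mul_of_nonneg_left (hVc m) (abs_nonneg _)
      _ = (∑ m, |V⁻¹ j m|) * R := by rw [Finset.sum_mul]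
      _ ≤ S * R := by
        refine mul_le_mul_of_nonneg_right ?_ (by positivity)
        exact Finset.single_le_sum (f := fun k => ∑ m, |V⁻¹ k m|)
          (fun _ _ => Finset.sum_nonneg fun _ _ => abs_nonneg _) (Finset.mem_univ j)
  have hk0 : (0 : ℝ) < k.factorial := by exact_mod_cast k.factorial_pos
  have h6 : |iteratedDeriv k f x| * δ ^ k = k.factorial * |c j| := by
    simp only [hc, hj, abs_div, abs_mul, abs_of_pos hk0, abs_of_nonneg (pow_nonneg hδ k)]
    field_simp
  rw [h6]
  calc _ ≤ (n.factorial : ℝ) * (S * R) := by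
        gcongr
    _ = _ := by rw [hR]; ring

theorem abs_sub_deriv_mul_le {g : ℝ → ℝ} (hg : ContDiff ℝ ∞ g) {C : ℝ}
    (hC : ∀ x, |iteratedDeriv 2 g x| ≤ C) (h : ℝ) :
    |g h - g 0 - deriv g 0 * h| ≤ C * h ^ 2 := by
  have key : ∀ {g : ℝ → ℝ}, ContDiff ℝ ∞ g → (∀ x, |iteratedDeriv 2 g x| ≤ C) → ∀ {h : ℝ}, 0 ≤ h →
      |g h - g 0 - deriv g 0 * h| ≤ C * h ^ 2 := by
    intro g hg hC h hh
    have := abs_sub_taylor_le hg (n := 1) hC 0 hh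
    simp only [Finset.sum_range_succ, Finset.sum_range_zero, zero_add, iteratedDeriv_zero,
      iteratedDeriv_one, pow_zero, pow_one, Nat.factorial, Nat.cast_one, mul_one, div_one] at this
    simpa [sub_sub] using this
  rcases le_total 0 h with hh | hh
  · exact key hg hC hh
  · have := key (g := fun x => g (-x)) (hg.comp contDiff_neg)
      (fun x => by rw [iteratedDeriv_comp_neg]; simpa using hC (-x)) (h := -h) (by linarith)
    rw [deriv_comp_neg] at this
    simpa using this

end Landau

/-! ### Smoothness of a partial derivative from separate bounds -/

section Mixed

/-- The partial derivative is a limit of difference quotients `K i` in `s` with step `σ i`.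
Successive quotients differ by `O(σ i)`, while their high `t`-derivatives grow only like `1 / σ i`.
Interpolating between the two bounds makes the lower `t`-derivatives of the differences summable. -/
theorem contDiff_deriv_of_bounded {G : ℝ → ℝ → ℝ} (ht : ∀ s, ContDiff ℝ ∞ fun t => G t s)
    (hs : ∀ t, ContDiff ℝ ∞ (G t))
    (hbt : ∀ k, ∃ C, ∀ t s, |iteratedDeriv k (fun t => G t s) t| ≤ C)
    (hbs : ∃ C, ∀ t s, |iteratedDeriv 2 (G t) s| ≤ C) :
    ContDiff ℝ ∞ fun t => deriv (G t) 0 := by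
  refine contDiff_infty.2 fun n => ?_
  set r := n + 1 with hr
  refine ContDiff.of_le (n := (r : ℕ∞)) ?_ (by exact_mod_cast Nat.le_succ n)
  obtain ⟨C, hC⟩ := hbs
  obtain ⟨B, hB⟩ := hbt (4 * r + 1)
  obtain ⟨Λ, hΛ0, hΛ⟩ := exists_abs_iteratedDeriv_le (4 * r)
  have hC0 : 0 ≤ C := (abs_nonneg _).trans (hC 0 0)
  have hB0 : 0 ≤ B := (abs_nonneg _).trans (hB 0 0)
  set x : ℕ → ℝ := fun i => (1 / 2) ^ i with hx
  have hx0 : ∀ i, 0 < x i := fun i => by positivity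
  have hx1 : ∀ i, x i ≤ 1 := fun i => pow_le_one₀ (by norm_num) (by norm_num)
  have hxs : ∀ i, x (i + 1) = x i / 2 := fun i => by simp only [hx, pow_succ]; ring
  -- The exponents are balanced for interpolation at scale `x i`: `x ^ (4r + 1) / σ = σ x ≤ σ`, and
  -- `σ ≤ x ^ (k + 1)` for `k ≤ r`, because `r ≥ 1`. This leaves the geometric bound `Q * x i`.
  set σ : ℕ → ℝ := fun i => x i ^ (2 * r) with hσ
  have hσ0 : ∀ i, 0 < σ i := fun i => by positivity
  have hσs : ∀ i, σ (i + 1) = σ i / 4 ^ r := fun i => by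
    simp only [hσ, hxs, div_pow]
    rw [pow_mul (2 : ℝ)]; norm_num
  set K : ℕ → ℝ → ℝ := fun i t => (σ i)⁻¹ * (G t (σ i) - G t 0) with hK
  have hKs : ∀ i, ContDiff ℝ ∞ (K i) := fun i => contDiff_const.mul ((ht _).sub (ht 0))
  have hKD : ∀ i t, |K i t - deriv (G t) 0| ≤ C * σ i := by
    intro i t
    have h1 := abs_sub_deriv_mul_le (hs t) (hC t) (σ i)
    have h2 : K i t - deriv (G t) 0 = (σ i)⁻¹ * (G t (σ i) - G t 0 - deriv (G t) 0 * σ i) := by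
      simp only [hK]
      field_simp [(hσ0 i).ne']
    rw [h2, abs_mul, abs_inv, abs_of_pos (hσ0 i), inv_mul_le_iff₀ (hσ0 i)]
    linarith
  have hKN : ∀ i t, |iteratedDeriv (4 * r + 1) (K i) t| ≤ 2 * B * (σ i)⁻¹ := by
    intro i t
    simp only [hK]
    rw [iteratedDeriv_const_mul_field, iteratedDeriv_fun_sub
      (contDiff_infty.1 (ht _) _).contDiffAt
      (contDiff_infty.1 (ht _) _).contDiffAt, abs_mul, abs_inv, abs_of_pos (hσ0 i),
      mul_comm]
    refine mul_le_mul_of_nonneg_right ?_ (inv_nonneg.2 (hσ0 i).le)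
    refine (abs_sub _ _).trans ?_
    linarith [hB t (σ i), hB t 0]
  set Q : ℝ := Λ * (2 * C + 4 * B * 4 ^ r) with hQ
  have hQ0 : 0 ≤ Q := by positivity
  have hbound : ∀ i t k, k ≤ r → |iteratedDeriv k (fun t => K (i + 1) t - K i t) t| ≤ Q * x i := by
    intro i t k hk
    have h4 : (1 : ℝ) ≤ 4 ^ r := one_le_pow₀ (by norm_num)
    have hA : ∀ t, |K (i + 1) t - K i t| ≤ 2 * C * σ i := by
      intro t
      have h1 := hKD i t
      have h2 := hKD (i + 1) t
      have h3 : σ (i + 1) ≤ σ i := by rw [hσs]; exact div_le_self (hσ0 i).le h4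
      have h5 := abs_sub_le (K (i + 1) t) (deriv (G t) 0) (K i t)
      rw [abs_sub_comm (deriv (G t) 0)] at h5
      have := mul_le_mul_of_nonneg_left h3 hC0
      linarith
    have hN : ∀ t, |iteratedDeriv (4 * r + 1) (fun t => K (i + 1) t - K i t) t| ≤
        4 * B * 4 ^ r * (σ i)⁻¹ := by
      intro t
      rw [iteratedDeriv_fun_sub (contDiff_infty.1 (hKs _) _).contDiffAt
        (contDiff_infty.1 (hKs _) _).contDiffAt]
      have h1 := hKN i t
      have h2 := hKN (i + 1) t
      rw [hσs, inv_div] at h2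
      refine (abs_sub _ _).trans ((add_le_add h2 h1).trans ?_)
      have h6 : 2 * B * (σ i)⁻¹ ≤ 2 * B * (4 ^ r / σ i) := by
        rw [div_eq_mul_inv]
        have := hσ0 i
        gcongr
        exact le_mul_of_one_le_left (by positivity) h4
      calc _ ≤ 2 * B * (4 ^ r / σ i) + 2 * B * (4 ^ r / σ i) := by linarith
        _ = _ := by rw [div_eq_mul_inv]; ring
    have h := hΛ _ _ _ (x i) ((hKs (i + 1)).sub (hKs i)) hA hN (hx0 i).le k (by omega) t
    have e1 : (σ i)⁻¹ * x i ^ (4 * r + 1) = σ i * x i := by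
      rw [inv_mul_eq_iff_eq_mul₀ (hσ0 i).ne']
      simp only [hσ]; ring
    have h7 : Λ * (2 * C * σ i + 4 * B * 4 ^ r * (σ i)⁻¹ * x i ^ (4 * r + 1)) ≤ Q * σ i := by
      rw [mul_assoc (4 * B * 4 ^ r), e1, hQ, mul_assoc Λ]
      refine mul_le_mul_of_nonneg_left ?_ hΛ0
      have : σ i * x i ≤ σ i := mul_le_of_le_one_right (hσ0 i).le (hx1 i)
      have := mul_le_mul_of_nonneg_left this (by positivity : 0 ≤ 4 * B * 4 ^ r)
      linarith
    have h8 : σ i ≤ x i * x i ^ k := by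
      rw [← pow_succ']
      exact pow_le_pow_of_le_one (hx0 i).le (hx1 i) (by omega)
    have h9 : |iteratedDeriv k (fun t => K (i + 1) t - K i t) t| * x i ^ k ≤
        Q * x i * x i ^ k := by
      calc _ ≤ _ := h
        _ ≤ _ := h7
        _ ≤ Q * (x i * x i ^ k) := mul_le_mul_of_nonneg_left h8 hQ0
        _ = _ := by ring
    exact le_of_mul_le_mul_right h9 (pow_pos (hx0 i) k)
  have hsum : Summable fun i => Q * x i :=
    (summable_geometric_of_lt_one (by norm_num) (by norm_num)).mul_left Q
  have hσlim : Tendsto σ atTop (𝓝 0) := by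
    have : Tendsto x atTop (𝓝 0) := tendsto_pow_atTop_nhds_zero_of_lt_one (by norm_num) (by norm_num)
    simpa [hσ] using this.pow (2 * r)
  have hD : (fun t => deriv (G t) 0) = fun t => K 0 t + ∑' i, (K (i + 1) t - K i t) := by
    funext t
    have hs1 : Summable fun i => K (i + 1) t - K i t := by
      refine Summable.of_norm_bounded hsum fun i => ?_
      simpa using hbound i t 0 (Nat.zero_le _)
    have h1 := hs1.hasSum.tendsto_sum_nat
    simp only [Finset.sum_range_sub (fun i => K i t)] at h1
    have h2 : Tendsto (fun i => K i t) atTop (𝓝 (deriv (G t) 0)) := by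
      rw [tendsto_iff_norm_sub_tendsto_zero]
      refine squeeze_zero (fun _ => norm_nonneg _) (fun i => hKD i t) ?_
      simpa using hσlim.const_mul C
    have h3 := tendsto_nhds_unique h1 (h2.sub_const (K 0 t))
    linarith
  rw [hD]
  refine ((hKs 0).of_le (by exact_mod_cast le_top)).add ?_
  refine contDiff_tsum (v := fun _ i => Q * x i) (N := (r : ℕ∞))
    (fun i => ((hKs (i + 1)).sub (hKs i)).of_le (by exact_mod_cast le_top))
    (fun _ _ => hsum) ?_
  intro k i t hk
  rw [norm_iteratedFDeriv_eq_norm_iteratedDeriv]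
  exact hbound i t k (by exact_mod_cast hk)

end Mixed

/-! ### The special curve lemma -/

section SpecialCurve

theorem exists_bound_iteratedDeriv_of_hasCompactSupport {f : ℝ → ℝ} (hf : ContDiff ℝ ∞ f)
    (hc : HasCompactSupport f) (k : ℕ) : ∃ C, 0 ≤ C ∧ ∀ x, |iteratedDeriv k f x| ≤ C := by
  have h1 : Continuous (iteratedFDeriv ℝ k f) :=
    hf.continuous_iteratedFDeriv (by exact_mod_cast le_top)
  obtain ⟨C, hC⟩ := (hc.iteratedFDeriv (𝕜 := ℝ) k).exists_bound_of_continuous h1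
  refine ⟨C, (norm_nonneg _).trans (hC 0), fun x => ?_⟩
  have := hC x
  rwa [norm_iteratedFDeriv_eq_norm_iteratedDeriv] at this

/-- The special curve lemma: there are times `τ n → 0` such that any sequence of affine germs
which converges to zero sufficiently fast is interpolated at the times `τ n` by a smooth
function. -/
theorem exists_smooth_interpolation : ∃ δ τ : ℕ → ℝ, (∀ n, 0 < δ n) ∧ Tendsto τ atTop (𝓝 0) ∧
    ∀ α β : ℕ → ℝ, (∀ n, |α n| ≤ δ n) → (∀ n, |β n| ≤ δ n) →
      ∃ f : ℝ → ℝ, ContDiff ℝ ∞ f ∧ ∀ n, f =ᶠ[𝓝 (τ n)] fun x => α n + β n * (x - τ n) := by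
  set τ : ℕ → ℝ := fun n => (1 / 2) ^ n with hτ
  have hτ0 : ∀ n, 0 < τ n := fun n => by positivity
  -- With outer radius `τ n / 4` the bumps at the dyadic points `τ n` have disjoint supports.
  let φ : ∀ n, ContDiffBump (τ n) := fun n =>
    ⟨τ n / 8, τ n / 4, by linarith [hτ0 n], by linarith [hτ0 n]⟩
  have hφs : ∀ n, ContDiff ℝ ∞ (φ n) := fun n => (φ n).contDiff
  let χ : ℕ → ℝ → ℝ := fun n x => (x - τ n) * φ n x
  have hχs : ∀ n, ContDiff ℝ ∞ (χ n) := fun n => (contDiff_id.sub contDiff_const).mul (hφs n)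
  have hφc : ∀ n, HasCompactSupport (φ n) := fun n => (φ n).hasCompactSupport
  have hχc : ∀ n, HasCompactSupport (χ n) := fun n => (hφc n).mul_left
  choose M hM0 hM using fun n k => exists_bound_iteratedDeriv_of_hasCompactSupport (hφs n) (hφc n) k
  choose N hN0 hN using fun n k => exists_bound_iteratedDeriv_of_hasCompactSupport (hχs n) (hχc n) k
  -- `W n` dominates the bounds for all derivatives of order at most `n`, so with `δ n = τ n / W n`
  -- the derivatives of order `k` of the terms `n ≥ k` are at most `τ n`.
  let W : ℕ → ℝ := fun n => 1 + ∑ k ∈ Finset.range (n + 1), (M n k + N n k)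
  have hW0 : ∀ n, 0 < W n := fun n => by
    have : 0 ≤ ∑ k ∈ Finset.range (n + 1), (M n k + N n k) :=
      Finset.sum_nonneg fun k _ => add_nonneg (hM0 n k) (hN0 n k)
    simp only [W]; linarith
  have hWle : ∀ n k, k ≤ n → M n k + N n k ≤ W n := fun n k hk => by
    have := Finset.single_le_sum (f := fun k => M n k + N n k)
      (fun k _ => add_nonneg (hM0 n k) (hN0 n k)) (Finset.mem_range.2 (Nat.lt_succ_of_le hk))
    simp only [W]; linarith
  refine ⟨fun n => τ n / W n, τ, fun n => div_pos (hτ0 n) (hW0 n),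
    tendsto_pow_atTop_nhds_zero_of_lt_one (by norm_num) (by norm_num), ?_⟩
  intro α β hα hβ
  refine ⟨fun x => ∑' n, (α n * φ n x + β n * χ n x), ?_, ?_⟩
  · refine contDiff_tsum_of_eventually (v := fun _ n => τ n) (N := ⊤)
      (fun n => (contDiff_const.mul (hφs n)).add (contDiff_const.mul (hχs n)))
      (fun _ _ => summable_geometric_of_lt_one (by norm_num) (by norm_num)) ?_
    intro k _
    rw [Nat.cofinite_eq_atTop]
    filter_upwards [eventually_ge_atTop k] with n hn x
    rw [norm_iteratedFDeriv_eq_norm_iteratedDeriv, iteratedDeriv_fun_add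
      (contDiff_infty.1 (contDiff_const.mul (hφs n)) _).contDiffAt
      (contDiff_infty.1 (contDiff_const.mul (hχs n)) _).contDiffAt,
      iteratedDeriv_const_mul_field, iteratedDeriv_const_mul_field]
    calc _ ≤ |α n| * |iteratedDeriv k (φ n) x| + |β n| * |iteratedDeriv k (χ n) x| := by
          rw [← abs_mul, ← abs_mul]; exact abs_add_le _ _
      _ ≤ τ n / W n * M n k + τ n / W n * N n k := by
          have := div_pos (hτ0 n) (hW0 n)
          gcongr
          · exact hα n
          · exact hM n k x
          · exact hβ n
          · exact hN n k x
      _ = τ n / W n * (M n k + N n k) := by ring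
      _ ≤ τ n / W n * W n := by
          have := div_pos (hτ0 n) (hW0 n)
          gcongr
          exact hWle n k hn
      _ = τ n := div_mul_cancel₀ _ (hW0 n).ne'
  · intro n
    filter_upwards [Metric.closedBall_mem_nhds (τ n) (show 0 < τ n / 8 by linarith [hτ0 n])]
      with x hx
    have h1 : φ n x = 1 := (φ n).one_of_mem_closedBall hx
    rw [Metric.mem_closedBall, Real.dist_eq, abs_le] at hx
    rw [tsum_eq_single n]
    · simp only [χ, h1]; ring
    · intro m hm
      have h0 : φ m x = 0 := by
        apply (φ m).zero_of_le_dist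
        change τ m / 4 ≤ dist x (τ m)
        rw [Real.dist_eq, le_abs]
        rcases lt_or_gt_of_ne hm with h | h
        · right
          have : τ n ≤ τ (m + 1) := pow_le_pow_of_le_one (by norm_num) (by norm_num) h
          have e : τ (m + 1) = τ m / 2 := by simp only [hτ, pow_succ]; ring
          linarith [hτ0 m]
        · left
          have : τ m ≤ τ (n + 1) := pow_le_pow_of_le_one (by norm_num) (by norm_num) h
          have e : τ (n + 1) = τ n / 2 := by simp only [hτ, pow_succ]; ring
          linarith [hτ0 m]
      simp [χ, h0]

end SpecialCurve

/-! ### Arc-smooth functions of two variables -/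

section ArcSmooth

/-- A function of two real variables is arc-smooth if it maps smooth curves to smooth curves. -/
def ArcSmooth (G : ℝ → ℝ → ℝ) : Prop :=
  ∀ a b : ℝ → ℝ, ContDiff ℝ ∞ a → ContDiff ℝ ∞ b → ContDiff ℝ ∞ fun t => G (a t) (b t)

theorem ArcSmooth.swap {G : ℝ → ℝ → ℝ} (hG : ArcSmooth G) : ArcSmooth fun s t => G t s :=
  fun a b ha hb => hG b a hb ha

theorem ArcSmooth.left {G : ℝ → ℝ → ℝ} (hG : ArcSmooth G) (s : ℝ) :
    ContDiff ℝ ∞ fun t => G t s := hG _ _ contDiff_id contDiff_const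

theorem ArcSmooth.right {G : ℝ → ℝ → ℝ} (hG : ArcSmooth G) (t : ℝ) : ContDiff ℝ ∞ (G t) :=
  hG _ _ contDiff_const contDiff_id

/-- Otherwise the special curve lemma threads one smooth curve through a sequence of points where
the derivative explodes, and `G` along that curve is not smooth at `0`. -/
theorem ArcSmooth.locally_bounded {G : ℝ → ℝ → ℝ} (hG : ArcSmooth G) (k : ℕ) (t₀ s₀ : ℝ) :
    ∃ ρ > 0, ∃ C, ∀ t s, |t - t₀| ≤ ρ → |s - s₀| ≤ ρ → |iteratedDeriv k (G t) s| ≤ C := by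
  by_contra! hcon
  obtain ⟨δ, τ, hδ, hτ, hint⟩ := exists_smooth_interpolation
  -- The curve will be constant in `t` and of speed `δ n` in `s` near `τ n`. The chain rule
  -- contributes `δ n ^ k`, which this threshold compensates, leaving at least `n`.
  choose t s ht hs hts using fun n : ℕ => hcon (δ n) (hδ n) (n / δ n ^ k)
  obtain ⟨f, hf, hfτ⟩ := hint (fun n => t n - t₀) 0 ht (fun n => by simpa using (hδ n).le)
  obtain ⟨g, hg, hgτ⟩ := hint (fun n => s n - s₀) δ hs (fun n => (abs_of_pos (hδ n)).le)
  have hh := hG (fun x => t₀ + f x) (fun x => s₀ + g x) (contDiff_const.add hf)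
    (contDiff_const.add hg)
  set h : ℝ → ℝ := fun x => G (t₀ + f x) (s₀ + g x) with h_def
  have key : ∀ n : ℕ, (n : ℝ) ≤ |iteratedDeriv k h (τ n)| := by
    intro n
    have h1 : h =ᶠ[𝓝 (τ n)] fun x => G (t n) (δ n * x + (s n - δ n * τ n)) := by
      filter_upwards [hfτ n, hgτ n] with x hx hy
      simp only [h_def, hx, hy, Pi.zero_apply]
      congr 1 <;> ring
    rw [h1.iteratedDeriv_eq]
    have h2 : ContDiff ℝ k fun y => G (t n) (y + (s n - δ n * τ n)) :=
      contDiff_infty.1 ((hG.right (t n)).comp (contDiff_id.add contDiff_const)) k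
    rw [iteratedDeriv_comp_const_mul h2 (δ n), iteratedDeriv_comp_add_const]
    simp only [add_sub_cancel]
    rw [abs_mul, abs_of_pos (pow_pos (hδ n) k)]
    have := (hts n).le
    rw [div_le_iff₀ (pow_pos (hδ n) k)] at this
    linarith
  have hlim : Tendsto (fun n => |iteratedDeriv k h (τ n)|) atTop (𝓝 |iteratedDeriv k h 0|) :=
    (((hh.continuous_iteratedDeriv k (by exact_mod_cast le_top)).tendsto 0).comp hτ).abs
  exact not_tendsto_nhds_of_tendsto_atTop
    (tendsto_atTop_mono key tendsto_natCast_atTop_atTop) _ hlim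

theorem ArcSmooth.bounded_of_periodic {G : ℝ → ℝ → ℝ} (hG : ArcSmooth G) {P : ℝ} (hP : 0 < P)
    (h₁ : ∀ t s, G (t + P) s = G t s) (h₂ : ∀ t s, G t (s + P) = G t s) (k : ℕ) :
    ∃ C, ∀ t s, |iteratedDeriv k (G t) s| ≤ C := by
  have hK : ∃ C, ∀ p ∈ Icc (0 : ℝ) P ×ˢ Icc (0 : ℝ) P, |iteratedDeriv k (G p.1) p.2| ≤ C := by
    refine (isCompact_Icc.prod isCompact_Icc).induction_on
      (p := fun S : Set (ℝ × ℝ) => ∃ C, ∀ p ∈ S, |iteratedDeriv k (G p.1) p.2| ≤ C)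
      ⟨0, by simp⟩ (fun S T hST ⟨C, hC⟩ => ⟨C, fun p hp => hC p (hST hp)⟩) ?_ ?_
    · rintro S T ⟨C, hC⟩ ⟨D, hD⟩
      exact ⟨max C D, fun p hp => hp.elim (fun h => (hC p h).trans (le_max_left _ _))
        (fun h => (hD p h).trans (le_max_right _ _))⟩
    · rintro ⟨t, s⟩ -
      obtain ⟨ρ, hρ, C, hC⟩ := hG.locally_bounded k t s
      refine ⟨Metric.closedBall (t, s) ρ,
        mem_nhdsWithin_of_mem_nhds (Metric.closedBall_mem_nhds _ hρ), C, fun p hp => ?_⟩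
      rw [← closedBall_prod_same] at hp
      exact hC _ _ hp.1 hp.2
  obtain ⟨C, hC⟩ := hK
  refine ⟨C, fun t s => ?_⟩
  have hp₁ : Function.Periodic (fun t => iteratedDeriv k (G t) s) P := fun t => by
    have : G (t + P) = G t := funext fun s => h₁ t s
    simp only [this]
  obtain ⟨t', ht', e₁⟩ := hp₁.exists_mem_Ico₀ hP t
  have hp₂ : Function.Periodic (iteratedDeriv k (G t')) P := fun s => by
    have h := iteratedDeriv_comp_add_const k (G t') P
    rw [funext fun s => h₂ t' s] at h
    exact (congrFun h s).symm
  obtain ⟨s', hs', e₂⟩ := hp₂.exists_mem_Ico₀ hP s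
  rw [show iteratedDeriv k (G t) s = iteratedDeriv k (G t') s from e₁, e₂]
  exact hC (t', s') ⟨Ico_subset_Icc_self ht', Ico_subset_Icc_self hs'⟩

theorem ArcSmooth.contDiff_deriv {G : ℝ → ℝ → ℝ} (hG : ArcSmooth G) {P : ℝ} (hP : 0 < P)
    (h₁ : ∀ t s, G (t + P) s = G t s) (h₂ : ∀ t s, G t (s + P) = G t s) :
    ContDiff ℝ ∞ fun t => deriv (G t) 0 :=
  contDiff_deriv_of_bounded hG.left hG.right
    (fun k => by
      obtain ⟨C, hC⟩ := hG.swap.bounded_of_periodic hP (fun s t => h₂ t s) (fun s t => h₁ t s) k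
      exact ⟨C, fun t s => hC s t⟩)
    (hG.bounded_of_periodic hP h₁ h₂ 2)

/-- Chain rule on the diagonal: expand in the second variable with a uniform `O(r²)` remainder, and
use that the first-order coefficient is differentiable in `r`. -/
theorem ArcSmooth.deriv_diag {G : ℝ → ℝ → ℝ} (hG : ArcSmooth G) {P : ℝ} (hP : 0 < P)
    (h₁ : ∀ t s, G (t + P) s = G t s) (h₂ : ∀ t s, G t (s + P) = G t s) :
    deriv (fun r => G r r) 0 = deriv (fun t => G t 0) 0 + deriv (G 0) 0 := by
  obtain ⟨C, hC⟩ := hG.bounded_of_periodic hP h₁ h₂ 2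
  have hD := hG.contDiff_deriv hP h₁ h₂
  have hq : HasDerivAt (fun r => G r r - G r 0 - deriv (G r) 0 * r) 0 0 := by
    have hO : (fun r => G r r - G r 0 - deriv (G r) 0 * r) =O[𝓝 0] fun r : ℝ => r ^ 2 :=
      Asymptotics.IsBigO.of_bound C (Eventually.of_forall fun r => by
        simpa using abs_sub_deriv_mul_le (hG.right r) (hC r) r)
    rw [hasDerivAt_iff_isLittleO_nhds_zero]
    simpa using hO.trans_isLittleO (Asymptotics.isLittleO_pow_id one_lt_two)
  have h1 : HasDerivAt (fun r => deriv (G r) 0 * r) (deriv (G 0) 0) 0 := by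
    simpa using ((hD.differentiable (by simp)) 0).hasDerivAt.fun_mul (hasDerivAt_id' (0 : ℝ))
  have h2 : HasDerivAt (fun r => G r 0) (deriv (fun t => G t 0) 0) 0 :=
    (((hG.left 0).differentiable (by simp)) 0).hasDerivAt
  have h3 := (hq.add h2).add h1
  have e : (fun r => G r r) = ((fun r => G r r - G r 0 - deriv (G r) 0 * r) + fun r => G r 0) +
      fun r => deriv (G r) 0 * r := by
    funext r; simp only [Pi.add_apply]; ring
  rw [e, h3.deriv, zero_add]

end ArcSmooth

/-! ### Directional derivatives of convenient smooth functions -/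

section LineDeriv

theorem deriv_line_smul {E : Type*} [AddCommGroup E] [Module ℝ E] (f : E → ℝ) (u : E) (a : ℝ) (v : E) :
    deriv (fun t : ℝ => f (u + t • a • v)) 0 = a * deriv (fun t : ℝ => f (u + t • v)) 0 := by
  have := deriv_comp_mul_left a (fun t : ℝ => f (u + t • v)) 0
  simp only [mul_zero, smul_eq_mul] at this
  rw [← this]
  congr 1
  funext t
  rw [smul_smul, mul_comm]

variable {E : Type*} [AddCommGroup E] [Module ℝ E] [TopologicalSpace E]
  [IsTopologicalAddGroup E] [ContinuousSMul ℝ E]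

theorem exists_line_mem {U : Set E} (hU : IsOpen U) {γ : ℝ → E} (hγ : Continuous γ) {t₀ : ℝ}
    (h₀ : γ t₀ ∈ U) (v : E) :
    ∃ ε > 0, ∀ t s : ℝ, |t| ≤ ε → |s| ≤ ε → γ (t₀ + t) + s • v ∈ U := by
  have hc : Continuous fun p : ℝ × ℝ => γ (t₀ + p.1) + p.2 • v := by fun_prop
  have hm : (fun p : ℝ × ℝ => γ (t₀ + p.1) + p.2 • v) ⁻¹' U ∈ 𝓝 ((0, 0) : ℝ × ℝ) :=
    hc.continuousAt.preimage_mem_nhds (hU.mem_nhds (by simpa using h₀))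
  obtain ⟨ε, hε, hsub⟩ := Metric.nhds_basis_closedBall.mem_iff.1 hm
  refine ⟨ε, hε, fun t s ht hs => hsub (a := (t, s)) ?_⟩
  rw [← closedBall_prod_same]
  exact ⟨by simpa using ht, by simpa using hs⟩

theorem abs_mul_sin_le {ε : ℝ} (hε : 0 < ε) (t : ℝ) : |ε * Real.sin t| ≤ ε := by
  rw [abs_mul, abs_of_pos hε]
  exact mul_le_of_le_one_right hε.le (Real.abs_sin_le_one t)

theorem contDiff_mul_sin {ε : ℝ} {a : ℝ → ℝ} (ha : ContDiff ℝ ∞ a) :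
    ContDiff ℝ ∞ fun t => ε * Real.sin (a t) :=
  contDiff_const.mul (Real.contDiff_sin.comp ha)

theorem hasDerivAt_mul_sin (ε : ℝ) : HasDerivAt (fun s => ε * Real.sin s) ε 0 := by
  simpa using (Real.hasDerivAt_sin 0).const_mul ε

/-- A function is smooth near `x₀` if it becomes smooth after the periodic substitution
`t ↦ x₀ + ε sin t`. -/
theorem contDiffAt_of_comp_mul_sin {g : ℝ → ℝ} {x₀ ε : ℝ} (hε : 0 < ε)
    (hg : ContDiff ℝ ∞ fun t => g (x₀ + ε * Real.sin t)) : ContDiffAt ℝ ∞ g x₀ := by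
  have h1 : ContDiffAt ℝ ∞ (fun x => Real.arcsin ((x - x₀) / ε)) x₀ := by
    refine ContDiffAt.comp (g := Real.arcsin) (f := fun x => (x - x₀) / ε) x₀ ?_
      ((contDiff_id.sub contDiff_const).div_const ε).contDiffAt
    exact Real.contDiffAt_arcsin (by simp) (by simp)
  have h2 := hg.contDiffAt.comp x₀ h1
  refine h2.congr_of_eventuallyEq ?_
  filter_upwards [Metric.closedBall_mem_nhds x₀ hε] with x hx
  rw [Metric.mem_closedBall, Real.dist_eq, abs_le] at hx
  have : Real.sin (Real.arcsin ((x - x₀) / ε)) = (x - x₀) / ε :=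
    Real.sin_arcsin (by rw [le_div_iff₀ hε]; linarith) (by rw [div_le_iff₀ hε]; linarith)
  simp only [Function.comp_apply, this]
  congr 1
  field_simp
  ring

variable [LocallyConvexSpace ℝ E] [ConvenientSpace E] {f : E → ℝ} {U : Set E}

/-- Substituting `ε sin` keeps the arguments in `U` for all times and makes the function periodic,
so that local bounds become global ones. -/
theorem ConvSmoothOn.arcSmooth (hf : ConvSmoothOn f U) {γ : ℝ → E} (hγ : SmoothCurve γ) {t₀ ε : ℝ}
    (hε : 0 < ε) {v : E} (hmem : ∀ t s : ℝ, |t| ≤ ε → |s| ≤ ε → γ (t₀ + t) + s • v ∈ U) :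
    ArcSmooth fun t s => f (γ (t₀ + ε * Real.sin t) + (ε * Real.sin s) • v) := by
  intro a b ha hb
  refine smoothCurve_real_iff.1 (hf _ ?_ fun t =>
    hmem _ _ (abs_mul_sin_le hε _) (abs_mul_sin_le hε _))
  exact (hγ.comp (contDiff_const.add (contDiff_mul_sin ha))).add
    (SmoothCurve.smul (contDiff_mul_sin hb) (smoothCurve_const v))

theorem ConvSmoothOn.differentiableAt_line (hf : ConvSmoothOn f U) (hU : IsOpen U) {u : E}
    (hu : u ∈ U) (v : E) : DifferentiableAt ℝ (fun t : ℝ => f (u + t • v)) 0 := by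
  obtain ⟨ε, hε, hmem⟩ := exists_line_mem hU (γ := fun _ => u) continuous_const (t₀ := 0) hu v
  have hG := hf.arcSmooth (t₀ := 0) (smoothCurve_const u) hε hmem
  refine (contDiffAt_of_comp_mul_sin hε ?_).differentiableAt (n := ∞) (by simp)
  simpa using hG.right 0

theorem ConvSmoothOn.deriv_line_mul_sin (hf : ConvSmoothOn f U) (hU : IsOpen U) {u : E}
    (hu : u ∈ U) (v : E) (ε : ℝ) :
    deriv (fun s : ℝ => f (u + (ε * Real.sin s) • v)) 0 =
      ε * deriv (fun t : ℝ => f (u + t • v)) 0 := by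
  have h := (hf.differentiableAt_line hU hu v).hasDerivAt
  have h2 := hasDerivAt_mul_sin ε
  have h3 : HasDerivAt (fun t : ℝ => f (u + t • v)) (deriv (fun t : ℝ => f (u + t • v)) 0)
      (ε * Real.sin 0) := by simpa using h
  have h4 := h3.comp 0 h2
  rw [mul_comm]
  exact h4.deriv

theorem ConvSmoothOn.contDiff_deriv_line (hf : ConvSmoothOn f U) (hU : IsOpen U) {γ : ℝ → E}
    (hγ : SmoothCurve γ) (hγU : ∀ t, γ t ∈ U) (v : E) :
    ContDiff ℝ ∞ fun t => deriv (fun s : ℝ => f (γ t + s • v)) 0 := by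
  refine contDiff_iff_contDiffAt.2 fun t₀ => ?_
  obtain ⟨ε, hε, hmem⟩ := exists_line_mem hU hγ.continuous (hγU t₀) v
  have hG := (hf.arcSmooth hγ hε hmem).contDiff_deriv Real.two_pi_pos (by simp) (by simp)
  refine contDiffAt_of_comp_mul_sin hε ?_
  have h := (contDiff_const (c := ε⁻¹)).mul hG
  simpa only [hf.deriv_line_mul_sin hU (hγU _) v ε, inv_mul_cancel_left₀ hε.ne'] using h

/-- This is the diagonal chain rule for `(t, s) ↦ f (u + t • v + s • w)`, after the periodic
substitution. -/
theorem ConvSmoothOn.deriv_line_add (hf : ConvSmoothOn f U) (hU : IsOpen U) {u : E}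
    (hu : u ∈ U) (v w : E) :
    deriv (fun t : ℝ => f (u + t • (v + w))) 0 =
      deriv (fun t : ℝ => f (u + t • v)) 0 + deriv (fun t : ℝ => f (u + t • w)) 0 := by
  have hγ : SmoothCurve fun t : ℝ => u + t • v :=
    (smoothCurve_const u).add (SmoothCurve.smul contDiff_id (smoothCurve_const v))
  obtain ⟨ε, hε, hmem⟩ := exists_line_mem hU hγ.continuous (t₀ := 0) (by simpa using hu) w
  have h := (hf.arcSmooth hγ hε hmem).deriv_diag Real.two_pi_pos (by simp) (by simp)
  simp only [zero_add, Real.sin_zero, mul_zero, zero_smul, add_zero, add_assoc, ← smul_add] at h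
  rw [hf.deriv_line_mul_sin hU hu, hf.deriv_line_mul_sin hU hu, hf.deriv_line_mul_sin hU hu,
    ← mul_add] at h
  exact mul_left_cancel₀ hε.ne' h

end LineDeriv

/-! ### Bilinearity and smoothness of `dη` -/

namespace OneForm

variable {E : Type*} [AddCommGroup E] [Module ℝ E] [TopologicalSpace E]
  {M : Type*} [TopologicalSpace M] [ChartedSpace E M] (η : OneForm E M)
  {e : OpenPartialHomeomorph M E} {u : E}

theorem d_swap (v w : E) : η.d e u v w = -η.d e u w v := (neg_sub _ _).symm

theorem d_smul_left (a : ℝ) (v w : E) :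
    η.d e u (a • v) w = a * η.d e u v w := by
  have h1 := deriv_line_smul (fun u => η.rep e u w) u a v
  simp only [d, map_smul, smul_eq_mul, h1, deriv_const_mul_field]
  ring

theorem d_smul_right (a : ℝ) (v w : E) :
    η.d e u v (a • w) = a * η.d e u v w := by
  rw [η.d_swap v, η.d_smul_left, η.d_swap w]
  ring

variable [IsTopologicalAddGroup E] [ContinuousSMul ℝ E]

theorem convSmoothOn_apply (he : e ∈ atlas E M) (w : E) :
    ConvSmoothOn (fun u => η.rep e u w) e.target :=
  fun c hc hcU => (η.smooth e he c hc hcU).clm (evalAt w)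

variable [LocallyConvexSpace ℝ E] [ConvenientSpace E]

theorem d_add_left (he : e ∈ atlas E M) (hu : u ∈ e.target) (v v' w : E) :
    η.d e u (v + v') w = η.d e u v w + η.d e u v' w := by
  have h1 := (η.convSmoothOn_apply he w).deriv_line_add e.open_target hu v v'
  have h2 := deriv_fun_add ((η.convSmoothOn_apply he v).differentiableAt_line e.open_target hu w)
    ((η.convSmoothOn_apply he v').differentiableAt_line e.open_target hu w)
  simp only [d, map_add, h1, h2]
  ring

theorem d_add_right (he : e ∈ atlas E M) (hu : u ∈ e.target) (v w w' : E) :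
    η.d e u v (w + w') = η.d e u v w + η.d e u v w' := by
  rw [η.d_swap v, η.d_add_left he hu, η.d_swap w, η.d_swap w']
  ring

theorem contDiff_d (he : e ∈ atlas E M) {γ : ℝ → E} (hγ : SmoothCurve γ)
    (hγU : ∀ t, γ t ∈ e.target) (v w : E) : ContDiff ℝ ∞ fun t => η.d e (γ t) v w :=
  ((η.convSmoothOn_apply he w).contDiff_deriv_line e.open_target hγ hγU v).sub
    ((η.convSmoothOn_apply he v).contDiff_deriv_line e.open_target hγ hγU w)

end OneForm

/-! ### The Reeb vector and the splitting of `♭` -/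

namespace OneForm

variable {E : Type*} [AddCommGroup E] [Module ℝ E] [TopologicalSpace E]
  {M : Type*} [TopologicalSpace M] [ChartedSpace E M] {η : OneForm E M}
  {e : OpenPartialHomeomorph M E} {u ξ : E}

theorem rep_eq_zero (z : η.hor e u) : η.rep e u z = 0 := z.2

/-- `ξ` is the Reeb vector at `u`: `η(ξ) = 1` and `dη(ξ, ·) = 0`. -/
structure IsReeb (η : OneForm E M) (e : OpenPartialHomeomorph M E) (u ξ : E) : Prop where
  rep_eq_one : η.rep e u ξ = 1
  d_eq_zero : ∀ w, η.d e u ξ w = 0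

theorem IsContactForm.exists_isReeb (hη : η.IsContactForm) (he : e ∈ atlas E M)
    (hu : u ∈ e.target) : ∃ ξ, IsReeb η e u ξ := by
  obtain ⟨r, hr, hr0⟩ := hη.degenerate e he u hu
  have hne : η.rep e u r ≠ 0 := fun h => hr0 (hη.disjoint e he u hu r h hr)
  exact ⟨(η.rep e u r)⁻¹ • r, by simp [hne], fun w => by rw [d_smul_left, hr w, mul_zero]⟩

theorem IsReeb.d_right (h : IsReeb η e u ξ) (v : E) : η.d e u v ξ = 0 := by
  rw [d_swap, h.d_eq_zero, neg_zero]

theorem flat_reeb (h : IsReeb η e u ξ) (w : E) : η.flat e u ξ w = η.rep e u w := by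
  rw [flat, h.d_eq_zero, h.rep_eq_one, zero_add, one_mul]

theorem flat_reeb_right (h : IsReeb η e u ξ) (v : E) : η.flat e u v ξ = η.rep e u v := by
  rw [flat, h.d_right, h.rep_eq_one, zero_add, mul_one]

theorem flat_swap (v w : E) :
    η.flat e u v w = 2 * (η.rep e u v * η.rep e u w) - η.flat e u w v := by
  rw [flat, flat, d_swap]
  ring

/-- If `♭` is an isomorphism at a point, then every functional on the strong dual is an
evaluation, because `♭` is skew-symmetric up to the term `η ⊗ η`. -/
theorem exists_eq_eval (h : IsReeb η e u ξ) (T : E ≃L[ℝ] (E →L[ℝ] ℝ))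
    (hT : ∀ v w, T v w = η.flat e u v w) (ℓ : (E →L[ℝ] ℝ) →L[ℝ] ℝ) :
    ∃ w, ∀ l, ℓ l = l w := by
  set v := T.symm (ℓ.comp (T : E →L[ℝ] (E →L[ℝ] ℝ))) with hv
  have hTv : ∀ x, T v x = ℓ (T x) := fun x => by rw [hv, T.apply_symm_apply]; rfl
  -- By construction `ℓ(T x) = ♭(v)(x) = 2 η(v) η(x) - ♭(x)(v)`, and `η(x) = ♭(x)(ξ)`; this is `T x`
  -- evaluated at the witness.
  refine ⟨(2 * η.rep e u v) • ξ - v, fun l => ?_⟩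
  obtain ⟨x, rfl⟩ := T.surjective l
  rw [← hTv, map_sub, map_smul, hT, hT, hT, flat_reeb_right h, flat_swap, smul_eq_mul]
  ring

variable [IsTopologicalAddGroup E] [ContinuousSMul ℝ E]

/-- The projection onto `Hor` along the Reeb vector. -/
def horProj (h : IsReeb η e u ξ) : E →L[ℝ] η.hor e u :=
  (ContinuousLinearMap.id ℝ E - (η.rep e u).smulRight ξ).codRestrict (η.hor e u) fun v => by
    change η.rep e u (v - η.rep e u v • ξ) = 0
    simp [h.rep_eq_one]

theorem coe_horProj (h : IsReeb η e u ξ) (v : E) :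
    (horProj h v : E) = v - η.rep e u v • ξ := rfl

theorem horProj_coe (h : IsReeb η e u ξ) (z : η.hor e u) : horProj h z = z :=
  Subtype.ext (by rw [coe_horProj, rep_eq_zero, zero_smul, sub_zero])

theorem horProj_reeb (h : IsReeb η e u ξ) : horProj h ξ = 0 :=
  Subtype.ext (by simp [coe_horProj, h.rep_eq_one])

theorem horProj_add_smul (h : IsReeb η e u ξ) (v : E) :
    (horProj h v : E) + η.rep e u v • ξ = v := by
  rw [coe_horProj, sub_add_cancel]

section HorToFlat

variable (h : IsReeb η e u ξ) (Ψ : η.hor e u ≃L[ℝ] (η.hor e u →L[ℝ] ℝ))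

/-- The isomorphism `♭ : E ≃ E'` built from an isomorphism `Hor ≃ Hor'`. -/
noncomputable def flatEquivOfHor : E ≃L[ℝ] (E →L[ℝ] ℝ) :=
  ContinuousLinearEquiv.equivOfInverse
    ((ContinuousLinearMap.precomp ℝ (horProj h)).comp
      ((Ψ : η.hor e u →L[ℝ] (η.hor e u →L[ℝ] ℝ)).comp (horProj h)) +
        (η.rep e u).smulRight (η.rep e u))
    ((η.hor e u).subtypeL.comp ((Ψ.symm : (η.hor e u →L[ℝ] ℝ) →L[ℝ] η.hor e u).comp
      (ContinuousLinearMap.precomp ℝ (η.hor e u).subtypeL)) + (evalAt ξ).smulRight ξ)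
    (fun v => by
      set L : E →L[ℝ] ℝ := (Ψ (horProj h v)).comp (horProj h) + η.rep e u v • η.rep e u with hL
      change (Ψ.symm (L.comp (η.hor e u).subtypeL) : E) + L ξ • ξ = v
      have h1 : L.comp (η.hor e u).subtypeL = Ψ (horProj h v) := by
        ext y
        change Ψ (horProj h v) (horProj h y) + η.rep e u v * η.rep e u y = _
        rw [horProj_coe, rep_eq_zero, mul_zero, add_zero]
      have h2 : L ξ = η.rep e u v := by
        change Ψ (horProj h v) (horProj h ξ) + η.rep e u v * η.rep e u ξ = _
        rw [horProj_reeb, map_zero, h.rep_eq_one, mul_one, zero_add]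
      rw [h1, h2, Ψ.symm_apply_apply, horProj_add_smul])
    (fun L => by
      set z := Ψ.symm (L.comp (η.hor e u).subtypeL) with hz
      set v : E := z + L ξ • ξ with hv
      have h1 : η.rep e u v = L ξ := by
        rw [hv, map_add, rep_eq_zero, map_smul, h.rep_eq_one, zero_add, smul_eq_mul, mul_one]
      have h2 : horProj h v = z := by
        rw [hv, map_add, horProj_coe, map_smul, horProj_reeb, smul_zero, add_zero]
      ext w
      change Ψ (horProj h v) (horProj h w) + η.rep e u v * η.rep e u w = L w
      rw [h1, h2, hz, Ψ.apply_symm_apply]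
      change L (horProj h w) + _ = _
      conv_rhs => rw [← horProj_add_smul h w, map_add, map_smul, smul_eq_mul]
      ring)

theorem flatEquivOfHor_symm_apply (L : E →L[ℝ] ℝ) :
    (flatEquivOfHor h Ψ).symm L = (Ψ.symm (L.comp (η.hor e u).subtypeL) : E) + L ξ • ξ := rfl

end HorToFlat

variable [LocallyConvexSpace ℝ E] [ConvenientSpace E]

theorem d_horProj_right (h : IsReeb η e u ξ) (he : e ∈ atlas E M) (hu : u ∈ e.target) (v w : E) :
    η.d e u v (horProj h w) = η.d e u v w := by
  conv_rhs => rw [← horProj_add_smul h w, d_add_right _ he hu, d_smul_right, h.d_right]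
  simp

theorem d_horProj_left (h : IsReeb η e u ξ) (he : e ∈ atlas E M) (hu : u ∈ e.target) (v w : E) :
    η.d e u (horProj h v) w = η.d e u v w := by
  rw [d_swap, d_horProj_right h he hu, ← d_swap]

theorem flat_horProj (h : IsReeb η e u ξ) (he : e ∈ atlas E M) (hu : u ∈ e.target) (v w : E) :
    η.flat e u v (horProj h w) = η.d e u v w := by
  rw [flat, d_horProj_right h he hu, rep_eq_zero, mul_zero, add_zero]

theorem flatEquivOfHor_apply (h : IsReeb η e u ξ)
    (Ψ : η.hor e u ≃L[ℝ] (η.hor e u →L[ℝ] ℝ)) (he : e ∈ atlas E M) (hu : u ∈ e.target)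
    (hΨ : ∀ z y : η.hor e u, Ψ z y = η.d e u z y) (v w : E) :
    flatEquivOfHor h Ψ v w = η.flat e u v w := by
  change Ψ (horProj h v) (horProj h w) + η.rep e u v * η.rep e u w = _
  rw [hΨ, d_horProj_left h he hu, d_horProj_right h he hu, flat]

section FlatToHor

variable (h : IsReeb η e u ξ) (he : e ∈ atlas E M) (hu : u ∈ e.target)
  (T : E ≃L[ℝ] (E →L[ℝ] ℝ)) (hT : ∀ v w, T v w = η.flat e u v w)

/-- The isomorphism `Hor ≃ Hor'` induced by an isomorphism `♭ : E ≃ E'`. -/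
noncomputable def horEquivOfFlat : η.hor e u ≃L[ℝ] (η.hor e u →L[ℝ] ℝ) :=
  ContinuousLinearEquiv.equivOfInverse
    ((ContinuousLinearMap.precomp ℝ (η.hor e u).subtypeL).comp
      ((T : E →L[ℝ] (E →L[ℝ] ℝ)).comp (η.hor e u).subtypeL))
    ((horProj h).comp ((T.symm : (E →L[ℝ] ℝ) →L[ℝ] E).comp
      (ContinuousLinearMap.precomp ℝ (horProj h))))
    (fun z => by
      change horProj h (T.symm (((T z).comp (η.hor e u).subtypeL).comp (horProj h))) = z
      have : ((T z).comp (η.hor e u).subtypeL).comp (horProj h) = T z := by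
        ext w
        change T z (horProj h w) = T z w
        rw [hT, hT, flat_horProj h he hu, flat, rep_eq_zero, zero_mul, add_zero]
      rw [this, T.symm_apply_apply, horProj_coe])
    (fun l => by
      set v := T.symm (l.comp (horProj h)) with hv
      have hTv : ∀ w, η.flat e u v w = l (horProj h w) := fun w => by
        rw [← hT, hv, T.apply_symm_apply]; rfl
      have hrep : η.rep e u v = 0 := by
        rw [← flat_reeb_right h, hTv, horProj_reeb, map_zero]
      have hvp : (horProj h v : E) = v := by rw [coe_horProj, hrep, zero_smul, sub_zero]
      ext y
      change T (horProj h v) y = l y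
      rw [hvp, hT, hTv, horProj_coe])

theorem horEquivOfFlat_apply (z y : η.hor e u) :
    horEquivOfFlat h he hu T hT z y = η.d e u z y := by
  change T z y = _
  rw [hT, flat, rep_eq_zero, zero_mul, add_zero]

/-- Any extension of a functional on `Hor` may be used: two extensions differ by a multiple of `η =
♭(ξ)`, and the projection kills `ξ`. -/
theorem horEquivOfFlat_symm_apply (L : E →L[ℝ] ℝ) :
    (horEquivOfFlat h he hu T hT).symm (L.comp (η.hor e u).subtypeL) = horProj h (T.symm L) := by
  rw [ContinuousLinearEquiv.symm_apply_eq]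
  ext y
  rw [horEquivOfFlat_apply, d_horProj_left h he hu]
  change L y = _
  conv_lhs => rw [← T.apply_symm_apply L, hT, flat, rep_eq_zero, mul_zero, add_zero]

end FlatToHor

theorem isStronglySymplecticHor_of_flatIsIso (hη : η.IsContactForm) (hflat : η.FlatIsIso) :
    η.IsStronglySymplecticHor := by
  intro e he
  obtain ⟨Φ, hΦ, hsm, hsm'⟩ := hflat e he
  choose ξ hξ using fun u : e.target => hη.exists_isReeb he u.2
  refine ⟨fun u => horEquivOfFlat (hξ u) he u.2 (Φ u) (hΦ u),
    fun u => horEquivOfFlat_apply (hξ u) he u.2 (Φ u) (hΦ u), ?_, ?_⟩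
  · intro γ hγ z hz
    exact ⟨fun t => Φ (γ t) (z t), hsm γ hγ _ hz, fun _ _ => rfl⟩
  · intro γ hγ L hL
    simp only [horEquivOfFlat_symm_apply, coe_horProj]
    have hrep : SmoothCurve fun t => η.rep e (γ t) := η.smooth e he _ hγ fun t => (γ t).2
    -- The Reeb vector is the preimage of `η` under `♭`.
    have hξs : SmoothCurve fun t => ξ (γ t) := by
      have h1 := hsm' γ hγ _ hrep
      convert h1 using 2 with t
      rw [eq_comm, ContinuousLinearEquiv.symm_apply_eq]
      ext w
      rw [hΦ, flat_reeb (hξ (γ t))]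
    have hv := hsm' γ hγ L hL
    exact hv.sub (SmoothCurve.smul (hrep.pairing hv) hξs)

theorem flatIsIso_of_isStronglySymplecticHor (hη : η.IsContactForm)
    (hhor : η.IsStronglySymplecticHor) : η.FlatIsIso := by
  intro e he
  obtain ⟨Ψ, hΨ, -, hsm'⟩ := hhor e he
  choose ξ hξ using fun u : e.target => hη.exists_isReeb he u.2
  set T : e.target → (E ≃L[ℝ] (E →L[ℝ] ℝ)) := fun u => flatEquivOfHor (hξ u) (Ψ u) with hTdef
  have hT : ∀ (u : e.target) (v w : E), T u v w = η.flat e u v w := fun u =>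
    flatEquivOfHor_apply (hξ u) (Ψ u) he u.2 (hΨ u)
  have hrep : ∀ γ : ℝ → e.target, SmoothCurve (fun t => (γ t : E)) →
      SmoothCurve fun t => η.rep e (γ t) := fun γ hγ => η.smooth e he _ hγ fun t => (γ t).2
  -- The isomorphism at one fixed point `u` suffices to test curves in `E'`; it need not vary with
  -- time.
  have hdual : ∀ (u : e.target) (L : ℝ → (E →L[ℝ] ℝ)), (∀ w, ContDiff ℝ ∞ fun t => L t w) →
      SmoothCurve L := fun u L hL =>
    smoothCurve_dual_of_pointwise (T u) (exists_eq_eval (hξ u) (T u) (hT u)) hL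
  have hconst : ∀ γ : ℝ → e.target, SmoothCurve (fun t => (γ t : E)) → ∀ w,
      SmoothCurve fun t => T (γ t) w := by
    intro γ hγ w
    refine hdual (γ 0) _ fun w' => ?_
    simp only [hT, flat]
    exact (η.contDiff_d he hγ (fun t => (γ t).2) w w').add
      (((hrep γ hγ).contDiff_clm (evalAt w)).mul ((hrep γ hγ).contDiff_clm (evalAt w')))
  refine ⟨T, hT, ?_, ?_⟩
  · intro γ hγ v hv
    refine hdual (γ 0) _ fun w => ?_
    -- Skew symmetry moves the varying vector into the second slot: `♭(v)(w) = 2 η(v) η(w) -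
    -- ♭(w)(v)`, where `♭(w)` is already a smooth curve in `E'` for constant `w`.
    have h1 := (contDiff_const (c := (2 : ℝ))).mul
      (((hrep γ hγ).pairing hv).mul ((hrep γ hγ).contDiff_clm (evalAt w)))
    have h2 := h1.sub ((hconst γ hγ w).pairing hv)
    refine (congrArg (ContDiff ℝ ∞) (funext fun t => ?_)).mpr h2
    rw [hT, hT, flat_swap, evalAt_apply]
  · intro γ hγ L hL
    have hξs : SmoothCurve fun t => ξ (γ t) := by
      refine smoothCurve_iff_scalarwise.2 fun l => contDiff_iff_contDiffAt.2 fun t₀ => ?_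
      -- The horizontal part `x₀ - η(x₀) ξ` of the constant vector `x₀` is smooth in time, being the
      -- `Ψ`-preimage of `♭(x₀)` restricted to `Hor`. As `η(x₀) = 1` at `t₀`, division by `η(x₀)`
      -- gives `ξ` nearby.
      set x₀ := ξ (γ t₀) with hx₀
      have hz := hsm' γ hγ _ (hconst γ hγ x₀)
      have hz' : ∀ t, ((Ψ (γ t)).symm ((T (γ t) x₀).comp (η.hor e (γ t)).subtypeL) : E) =
          x₀ - η.rep e (γ t) x₀ • ξ (γ t) := by
        intro t
        rw [← coe_horProj (hξ (γ t)), Subtype.coe_inj, ContinuousLinearEquiv.symm_apply_eq]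
        ext y
        rw [hΨ, d_horProj_left (hξ (γ t)) he (γ t).2]
        change T (γ t) x₀ y = _
        rw [hT, flat, rep_eq_zero, mul_zero, add_zero]
      simp only [hz'] at hz
      have ha : ContDiff ℝ ∞ fun t => η.rep e (γ t) x₀ := (hrep γ hγ).contDiff_clm (evalAt x₀)
      have ha0 : η.rep e (γ t₀) x₀ ≠ 0 := by
        rw [hx₀, (hξ (γ t₀)).rep_eq_one]
        exact one_ne_zero
      have hq := ((contDiff_const (c := l x₀)).sub (hz.contDiff_clm l)).contDiffAt.div
        ha.contDiffAt ha0
      refine hq.congr_of_eventuallyEq ?_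
      filter_upwards [ha.continuous.continuousAt.eventually_ne ha0] with t ht
      rw [Pi.div_apply, eq_div_iff ht, map_sub, map_smul, smul_eq_mul]
      ring
    simp only [hTdef, flatEquivOfHor_symm_apply]
    exact (hsm' γ hγ L hL).add (SmoothCurve.smul (hL.pairing hξs) hξs)

end OneForm

end ConvenientContact

open ConvenientContact
theorem mainTheorem6 {E : Type*} [AddCommGroup E] [Module ℝ E] [TopologicalSpace E]
    [IsTopologicalAddGroup E] [ContinuousSMul ℝ E] [LocallyConvexSpace ℝ E] [T2Space E]
    [ConvenientSpace E]
    {M : Type*} [TopologicalSpace M] [ChartedSpace E M] [ConvenientManifold E M]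
    (η : OneForm E M) (hη : η.IsContactForm) :
    η.IsStronglySymplecticHor ↔ η.FlatIsIso :=
  ⟨η.flatIsIso_of_isStronglySymplecticHor hη, η.isStronglySymplecticHor_of_flatIsIso hη⟩
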